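/- Fix integers $R,M,C\ge 1$, $L\ge 1$ and an even $T\ge 2$, a $\sigma$-finite measure space $(\mathcal X,\mu)$ and functions $f_1,\dots,f_M:\mathcal X\to\mathbb R$ (the initial mapping functions) that are linearly independent (as functions on $\mathcal X$) and square-integrable with respect to $\mu$; write $f(\mathbf x)=(f_1(\mathbf x),\dots,f_M(\mathbf x))$. The recurrent arithmetic circuit (RAC) with $L$ layers, $R$ hidden channels per layer and $C$ classes has as parameters the weights $\Theta$, consisting of the matrices $W^{\mathrm I,1}\in\mathbb R^{R\times M}$, $W^{\mathrm I,l}\in\mathbb R^{R\times R}$ ($2\le l\le L$), $W^{\mathrm H,l}\in\mathbb R^{R\times R}$ ($1\le l\le L$), $W^{\mathrm O}\in\mathbb R^{C\times R}$, and the initial hidden states $\mathbf h^{0,l}\in\mathbb R^R$ ($1\le l\le L$). On inputs $\mathbf x^1,\dots,\mathbf x^T\in\mathcal X$ it computes, for $1\le t\le T$ and $1\le l\le L$, $$\mathbf h^{t,0}=f(\mathbf x^t),\qquad \mathbf h^{t,l}=\bigl(W^{\mathrm H,l}\mathbf h^{t-1,l}\bigr)\odot\bigl(W^{\mathrm I,l}\mathbf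 h^{t,l-1}\bigr),$$ where $\odot$ is the element-wise product, and its $c$-th class score after $T$ time-steps is $y^{T,L,\Theta}_c(\mathbf x^1,\dots,\mathbf x^T)=(W^{\mathrm O}\mathbf h^{T,L})_c$. For $y:\mathcal X^T\to\mathbb R$, the Start-End separation rank $\mathrm{sep}_{S,E}(y)$ is the least integer $K\ge 0$ for which there are functions $g^s_1,\dots,g^s_K,g^e_1,\dots,g^e_K:\mathcal X^{T/2}\to\mathbb R$ with $$y(\mathbf x^1,\dots,\mathbf x^T)=\sum_{\nu=1}^K g^s_\nu(\mathbf x^1,\dots,\mathbf x^{T/2})\,g^e_\nu(\mathbf x^{T/2+1},\dots,\mathbf x^T)\quad\text{for all }\mathbf x^1,\dots,\mathbf x^T\in\mathcal X,$$ and $\infty$ if there is no such $K$. Then, for all values of the parameters $(\Theta,(\mathbf h^{0,l})_{l})$ outside a set of Lebesgue measure zero, the following holds for every class $c\in\{1,\dots,C\}$: 1. if $L=1$, then $\mathrm{sep}_{S,E}(y^{T,1,\Theta}_c)=\min\{R,M^{T/2}\}$; 2. if $L=2$, then $\mathrm{sep}_{S,E}(y^{T,2,\Theta}_c)\ge\left(\!\binom{\min\{M,R\}}{T/2}\!\right)=\binom{\min\{M,R\}+T/2-1}{T/2}$.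 Both statements hold as well if the functions $g^s_\nu,g^e_\nu$ in the definition of $\mathrm{sep}_{S,E}$ are required to be square-integrable with respect to the product measure $\mu^{T/2}$. -/

import Mathlib

open MeasureTheory

namespace RAC

/-- The parameters of a recurrent arithmetic circuit of depth `L = n + 1` with `R` hidden channels
per layer, `M` initial mapping functions and `C` classes, listed as real coordinates:
the input weights `W^{I,1}` (`R × M`) of the first layer, the input weights `W^{I,l}` (`R × R`)
of the `n` layers above it, the hidden weights `W^{H,l}` (`R × R`) of the `n + 1` layers,
the output weights `W^O` (`C × R`), and the initial hidden states `h^{0,l}` of the `n + 1` layers.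
As a finite product of copies of `ℝ` it carries the Lebesgue measure `volume`. -/
abbrev Params (n R M C : ℕ) : Type :=
  (Fin R → Fin M → ℝ) × (Fin n → Fin R → Fin R → ℝ) × (Fin (n + 1) → Fin R → Fin R → ℝ) ×
    (Fin C → Fin R → ℝ) × (Fin (n + 1) → Fin R → ℝ)

variable {n R M C : ℕ}

/-- Input weights of the first layer. -/
def inputWeights (θ : Params n R M C) : Matrix (Fin R) (Fin M) ℝ := Matrix.of θ.1

/-- Input weights of the layer directly above layer `l` (layers are counted from `0`). -/
def upperInputWeights (θ : Params n R M C) (l : Fin n) : Matrix (Fin R) (Fin R) ℝ :=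
  Matrix.of (θ.2.1 l)

/-- Hidden weights of layer `l`. -/
def hiddenWeights (θ : Params n R M C) (l : Fin (n + 1)) : Matrix (Fin R) (Fin R) ℝ :=
  Matrix.of (θ.2.2.1 l)

/-- Output weights. -/
def outputWeights (θ : Params n R M C) : Matrix (Fin C) (Fin R) ℝ := Matrix.of θ.2.2.2.1

/-- Initial hidden state of layer `l`. -/
def initialState (θ : Params n R M C) (l : Fin (n + 1)) : Fin R → ℝ := θ.2.2.2.2 l

/-- One time-step: from the hidden states `h^{t-1,l}` of all layers and the mapped input
`v = h^{t,0}`, compute `h^{t,l} = (W^{H,l} h^{t-1,l}) ⊙ (W^{I,l} h^{t,l-1})`, upwards in `l`.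
Multiplication in `Fin R → ℝ` is element-wise. -/
def step (θ : Params n R M C) (v : Fin M → ℝ) (h : Fin (n + 1) → Fin R → ℝ) :
    Fin (n + 1) → Fin R → ℝ :=
  fun l => Fin.induction (motive := fun _ => Fin R → ℝ)
    ((hiddenWeights θ 0).mulVec (h 0) * (inputWeights θ).mulVec v)
    (fun l below =>
      (hiddenWeights θ l.succ).mulVec (h l.succ) * (upperInputWeights θ l).mulVec below)
    l

/-- The hidden states of all layers after `t` time-steps with inputs `x 0, …, x (t - 1)`. -/
def hidden {X : Type*} (f : Fin M → X → ℝ) (θ : Params n R M C) :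
    (t : ℕ) → (Fin t → X) → Fin (n + 1) → Fin R → ℝ
  | 0, _ => initialState θ
  | t + 1, x => step θ (fun d => f d (x (Fin.last t))) (hidden f θ t (Fin.init x))

/-- The `c`-th class score after `T` time-steps, `(W^O h^{T,L})_c`. -/
def score {X : Type*} (f : Fin M → X → ℝ) (θ : Params n R M C) (c : Fin C) {T : ℕ}
    (x : Fin T → X) : ℝ :=
  (outputWeights θ).mulVec (hidden f θ T x (Fin.last n)) c

/-- Start-End separation rank of a function of `T = k + k` inputs, with all the factors taken from
the class `P` of functions of `k` inputs: the least number of separable summands, and `⊤` if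
there is no such finite decomposition. -/
noncomputable def sepRankIn {X : Type*} {k : ℕ} (P : ((Fin k → X) → ℝ) → Prop)
    (y : (Fin (k + k) → X) → ℝ) : ℕ∞ :=
  sInf {K : ℕ∞ | ∃ N : ℕ, K = N ∧ ∃ gs ge : Fin N → (Fin k → X) → ℝ,
    (∀ ν, P (gs ν)) ∧ (∀ ν, P (ge ν)) ∧
    ∀ xs xe : Fin k → X, y (Fin.append xs xe) = ∑ ν, gs ν xs * ge ν xe}

/-- Start-End separation rank, with arbitrary real functions as factors. -/
noncomputable def sepRank {X : Type*} {k : ℕ} (y : (Fin (k + k) → X) → ℝ) : ℕ∞ :=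
  sepRankIn (fun _ => True) y

/-- Start-End separation rank, with the factors required to be square-integrable for the product
measure. -/
noncomputable def sepRankL2 {X : Type*} [MeasurableSpace X] (μ : Measure X) {k : ℕ}
    (y : (Fin (k + k) → X) → ℝ) : ℕ∞ :=
  sepRankIn (fun g => MemLp g 2 (Measure.pi fun _ : Fin k => μ)) y

end RAC

/-! Sampling start and end inputs at finitely many points turns the score into a matrix whose rank
is at most the number of summands in any decomposition. Its determinant is analytic in the
parameters, so a lower bound for almost all parameters needs only one parameter value where the
determinant is nonzero (`ae_card_le_sepRankIn`). Independence of `f` supplies `M` points at which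
the inputs to the first-layer channels can be prescribed freely (`exists_inputWeights`).

Depth 1: the start acts on the end only through a state in `ℝ^R`, and each coordinate of that state
lies in the span of the `M ^ k` products of mapping functions; this gives both upper bounds.
Conversely, reading a word is a product of matrices (`transfer`). Reading base-`M` digits steers the
state to any chosen basis vector, and transposition turns the reversed end word into a start word.
The sample matrix thus factors as `S(W) * Wᵀ * S(Wᵀ)ᵀ`, where row `i` of `S(W)` is the state reached
on word `i`, and each factor is nonsingular for generic `W`.

Depth 2: with identity hidden weights and a summing second layer, the score is, up to `R` and a
factor depending on the start alone, `∏ τ, ∑ r, a r * b τ r`, where `a` comes from the start and `b`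
from the end. Expanding in the degree-`k` monomials in the `m = min M R` variables `a r` factors the
sample matrix as diagonal times monomial values times coefficients
(`exists_det_two_layers_ne_zero`). Monomial values are nonsingular for one choice of inputs (a
narrow Gaussian kernel), coefficients for another (a unitriangular matrix). Both conditions are
generic, so some choice satisfies them together. -/

open MeasureTheory

namespace RAC

/-! ### Generic nonvanishing, rank bounds and sample points. -/

section Tools

open Filter

/-- A real-analytic function on a finite-dimensional space which does not vanish identically is
nonzero almost everywhere. -/
theorem ae_ne_zero_of_analyticAt {E : Type*} [NormedAddCommGroup E] [NormedSpace ℝ E]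
    [FiniteDimensional ℝ E] [MeasurableSpace E] [BorelSpace E] (μ : Measure E)
    [μ.IsAddHaarMeasure] {F : E → ℝ} (hF : ∀ x, AnalyticAt ℝ F x) {p : E} (hp : F p ≠ 0) :
    ∀ᵐ x ∂μ, F x ≠ 0 := by
  have hcont : Continuous F := continuous_iff_continuousAt.2 fun x => (hF x).continuousAt
  -- On each line through `p` the restriction is analytic in one variable and nonzero at `t = 0`, so
  -- its zeros are isolated.
  have hline : ∀ x : E, ∀ᵐ t : ℝ, F (p + t • x) ≠ 0 := by
    intro x
    have hg : AnalyticOnNhd ℝ (fun t : ℝ => F (p + t • x)) Set.univ := fun t _ => by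
      have : AnalyticAt ℝ (fun t : ℝ => p + t • x) t := by fun_prop
      exact (hF _).fun_comp this
    rcases hg.eqOn_zero_or_eventually_ne_zero_of_preconnected isPreconnected_univ with h | h
    · exact absurd (by simpa using h (Set.mem_univ 0)) hp
    · have := ae_restrict_le_codiscreteWithin (μ := (volume : Measure ℝ)) MeasurableSet.univ h
      rw [Measure.restrict_univ] at this
      exact this
  have hmeas : MeasurableSet {z : E × ℝ | F (p + z.2 • z.1) ≠ 0} := by
    have : Continuous fun z : E × ℝ => F (p + z.2 • z.1) := by fun_prop
    exact (isOpen_ne.preimage this).measurableSet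
  -- Fubini yields a single `t ≠ 0` that works for almost every `x`; dilations by `t` and
  -- translations preserve null sets.
  have h := (Measure.ae_ae_comm (μ := μ) (ν := (volume : Measure ℝ)) hmeas).1
    (Eventually.of_forall hline)
  obtain ⟨t, ht, ht0⟩ := (h.and (Measure.ae_ne volume (0 : ℝ))).exists
  have h1 : μ ((t • ·) ⁻¹' {x | F (p + x) = 0}) = 0 := by
    rw [ae_iff] at ht
    simpa using ht
  rw [Measure.addHaar_preimage_smul μ ht0] at h1
  have h2 : μ {x | F (p + x) = 0} = 0 := by
    rcases mul_eq_zero.1 h1 with h | h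
    · have : 0 < |(t ^ Module.finrank ℝ E)⁻¹| := by positivity
      simp only [ENNReal.ofReal_eq_zero] at h
      linarith
    · exact h
  have h3 := measure_preimage_add μ p {x | F x = 0}
  rw [ae_iff]
  simpa [← h3] using h2

theorem IsLinearMap.analyticAt_real {E : Type*} [NormedAddCommGroup E] [NormedSpace ℝ E]
    [FiniteDimensional ℝ E] {g : E → ℝ} (hg : IsLinearMap ℝ g) (x : E) : AnalyticAt ℝ g x :=
  (LinearMap.toContinuousLinearMap (hg.mk' g)).analyticAt x

theorem analyticAt_entry {a b : ℕ} (i : Fin a) (j : Fin b) (W₀ : Fin a → Fin b → ℝ) :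
    AnalyticAt ℝ (fun W : Fin a → Fin b → ℝ => W i j) W₀ :=
  IsLinearMap.analyticAt_real ⟨fun _ _ => rfl, fun _ _ => rfl⟩ _

theorem analyticAt_det {E ι : Type*} [NormedAddCommGroup E] [NormedSpace ℝ E] [Fintype ι]
    [DecidableEq ι] {A : E → Matrix ι ι ℝ} {x : E}
    (hA : ∀ i j, AnalyticAt ℝ (fun z => A z i j) x) :
    AnalyticAt ℝ (fun z => (A z).det) x := by
  simp only [Matrix.det_apply']
  exact Finset.analyticAt_fun_sum _ fun σ _ =>
    analyticAt_const.mul (Finset.analyticAt_fun_prod _ fun i _ => hA _ _)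

/-- A nonsingular matrix of values bounds the separation rank from below. -/
theorem card_le_sepRankIn {X ι : Type*} [Fintype ι] [DecidableEq ι] {k : ℕ}
    (P : ((Fin k → X) → ℝ) → Prop) (y : (Fin (k + k) → X) → ℝ) (xs xe : ι → Fin k → X)
    (h : (Matrix.of fun i j => y (Fin.append (xs i) (xe j))).det ≠ 0) :
    (Fintype.card ι : ℕ∞) ≤ sepRankIn P y := by
  refine le_sInf ?_
  rintro _ ⟨N, rfl, gs, ge, -, -, hy⟩
  have hmul : (Matrix.of fun i j => y (Fin.append (xs i) (xe j))) =
      (Matrix.of fun i ν => gs ν (xs i)) * (Matrix.of fun ν j => ge ν (xe j)) := by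
    ext i j
    simp [Matrix.mul_apply, hy]
  have h1 := Matrix.rank_of_isUnit _ ((Matrix.isUnit_iff_isUnit_det _).2 (isUnit_iff_ne_zero.2 h))
  rw [hmul] at h1
  rw [← h1]
  rw [Nat.cast_le]
  exact (Matrix.rank_mul_le_left _ _).trans
    ((Matrix.rank_le_card_width _).trans_eq (Fintype.card_fin N))

/-- Linearly independent functions are independent on suitable sample points. -/
theorem exists_points_det_ne_zero {X : Type*} {M : ℕ} {f : Fin M → X → ℝ}
    (hf : LinearIndependent ℝ f) :
    ∃ x : Fin M → X, (Matrix.of fun i j => f i (x j)).det ≠ 0 := by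
  let v : X → Fin M → ℝ := fun x i => f i x
  have hspan : Submodule.span ℝ (Set.range v) = ⊤ := by
    by_contra hne
    -- A functional vanishing on every value vector is a linear relation among the `f i`.
    obtain ⟨φ, hφ, hφ0⟩ := Submodule.exists_le_ker_of_lt_top _ (lt_top_iff_ne_top.2 hne)
    apply hφ
    have hz := Fintype.linearIndependent_iff.1 hf (fun i => φ (Pi.single i 1)) (by
      ext x
      have hx : φ (v x) = 0 := hφ0 (Submodule.subset_span ⟨x, rfl⟩)
      rw [LinearMap.pi_apply_eq_sum_univ] at hx
      simp only [Finset.sum_apply, Pi.smul_apply, Pi.zero_apply, smul_eq_mul]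
      rw [← hx]
      refine Finset.sum_congr rfl fun i _ => ?_
      have : (fun j => if i = j then (1 : ℝ) else 0) = Pi.single i 1 := by
        ext j; simp [Pi.single_apply, eq_comm]
      simp [v, mul_comm, this])
    refine LinearMap.pi_ext' fun i => ?_
    ext
    simpa using hz i
  obtain ⟨b, hbs, hbspan, hbind⟩ := exists_linearIndependent ℝ (Set.range v)
  rw [hspan] at hbspan
  let B := Module.Basis.mk hbind (by simp [hbspan])
  let e : Fin M ≃ b := (Pi.basisFun ℝ (Fin M)).indexEquiv B
  choose x hx using fun j => hbs (e j).2
  refine ⟨x, ?_⟩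
  have hli : LinearIndependent ℝ (fun j => ((e j : b) : Fin M → ℝ)) := hbind.comp e e.injective
  have hunit := Matrix.linearIndependent_cols_iff_isUnit (A := Matrix.of fun i j => f i (x j))
  have hcol : (Matrix.of fun i j => f i (x j)).col = fun j => ((e j : b) : Fin M → ℝ) := by
    ext j i
    simp [← hx, v, Matrix.col]
  rw [hcol] at hunit
  exact ((Matrix.isUnit_iff_isUnit_det _).1 (hunit.1 hli)).ne_zero

end Tools

/-! ### Analytic dependence of the score on the parameters. -/

section Analytic

variable {n R M C : ℕ}

theorem analyticAt_step {v : Fin M → ℝ} {h : Params n R M C → Fin (n + 1) → Fin R → ℝ}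
    {θ₀ : Params n R M C} (hh : ∀ l r, AnalyticAt ℝ (fun θ => h θ l r) θ₀) (l : Fin (n + 1))
    (r : Fin R) : AnalyticAt ℝ (fun θ => step θ v (h θ) l r) θ₀ := by
  have hW : ∀ l r s, AnalyticAt ℝ (fun θ : Params n R M C => θ.2.2.1 l r s) θ₀ := by
    intro l r s; exact IsLinearMap.analyticAt_real ⟨fun _ _ => rfl, fun _ _ => rfl⟩ _
  have hI : ∀ r s, AnalyticAt ℝ (fun θ : Params n R M C => θ.1 r s) θ₀ := by
    intro r s; exact IsLinearMap.analyticAt_real ⟨fun _ _ => rfl, fun _ _ => rfl⟩ _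
  have hU : ∀ l r s, AnalyticAt ℝ (fun θ : Params n R M C => θ.2.1 l r s) θ₀ := by
    intro l r s; exact IsLinearMap.analyticAt_real ⟨fun _ _ => rfl, fun _ _ => rfl⟩ _
  induction l using Fin.induction generalizing r with
  | zero =>
    simp only [step, Fin.induction_zero, Pi.mul_apply, Matrix.mulVec, dotProduct, hiddenWeights,
      inputWeights, Matrix.of_apply]
    exact (Finset.analyticAt_fun_sum _ fun s _ => (hW _ _ _).mul (hh _ _)).mul
      (Finset.analyticAt_fun_sum _ fun s _ => (hI _ _).mul analyticAt_const)
  | succ l ih =>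
    simp only [step, Fin.induction_succ, Pi.mul_apply, Matrix.mulVec, dotProduct, hiddenWeights,
      upperInputWeights, Matrix.of_apply]
    exact (Finset.analyticAt_fun_sum _ fun s _ => (hW _ _ _).mul (hh _ _)).mul
      (Finset.analyticAt_fun_sum _ fun s _ => (hU _ _ _).mul (ih s))

theorem analyticAt_hidden {X : Type*} (f : Fin M → X → ℝ) (t : ℕ) (x : Fin t → X)
    (l : Fin (n + 1)) (r : Fin R) (θ₀ : Params n R M C) :
    AnalyticAt ℝ (fun θ => hidden f θ t x l r) θ₀ := by
  induction t generalizing l r with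
  | zero => exact IsLinearMap.analyticAt_real ⟨fun _ _ => rfl, fun _ _ => rfl⟩ _
  | succ t ih => exact analyticAt_step (fun l r => ih _ l r) l r

theorem analyticAt_score {X : Type*} (f : Fin M → X → ℝ) (c : Fin C) {T : ℕ} (x : Fin T → X)
    (θ₀ : Params n R M C) : AnalyticAt ℝ (fun θ => score f θ c x) θ₀ := by
  have hO : ∀ r, AnalyticAt ℝ (fun θ : Params n R M C => θ.2.2.2.1 c r) θ₀ := by
    intro r; exact IsLinearMap.analyticAt_real ⟨fun _ _ => rfl, fun _ _ => rfl⟩ _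
  simp only [score, Matrix.mulVec, dotProduct, outputWeights, Matrix.of_apply]
  exact Finset.analyticAt_fun_sum _ fun r _ => (hO r).mul (analyticAt_hidden f T x _ r θ₀)

/-- The two properties travel as one proposition so that they can be assembled along the nested
product `Params`. -/
theorem isAddHaarMeasure_volume_prod {α β : Type*} [NormedAddCommGroup α] [NormedSpace ℝ α]
    [FiniteDimensional ℝ α] [MeasureSpace α] [NormedAddCommGroup β] [NormedSpace ℝ β]
    [FiniteDimensional ℝ β] [MeasureSpace β]
    (hα : BorelSpace α ∧ (volume : Measure α).IsAddHaarMeasure)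
    (hβ : BorelSpace β ∧ (volume : Measure β).IsAddHaarMeasure) :
    BorelSpace (α × β) ∧ (volume : Measure (α × β)).IsAddHaarMeasure := by
  obtain ⟨_, _⟩ := hα
  obtain ⟨_, _⟩ := hβ
  have := FiniteDimensional.proper_real α
  have := FiniteDimensional.proper_real β
  exact ⟨inferInstance, Measure.prod.instIsAddHaarMeasure volume volume⟩

theorem isAddHaarMeasure_volume_pi {α : Type*} [NormedAddCommGroup α] [NormedSpace ℝ α]
    [FiniteDimensional ℝ α] [MeasureSpace α] (a : ℕ)
    (hα : BorelSpace α ∧ (volume : Measure α).IsAddHaarMeasure) :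
    BorelSpace (Fin a → α) ∧ (volume : Measure (Fin a → α)).IsAddHaarMeasure := by
  obtain ⟨_, _⟩ := hα
  have := FiniteDimensional.proper_real α
  exact ⟨inferInstance, Measure.pi.isAddHaarMeasure fun _ => volume⟩

theorem isAddHaarMeasure_volume_pi_pi (a b : ℕ) :
    BorelSpace (Fin a → Fin b → ℝ) ∧ (volume : Measure (Fin a → Fin b → ℝ)).IsAddHaarMeasure :=
  isAddHaarMeasure_volume_pi _ (isAddHaarMeasure_volume_pi _ ⟨inferInstance, inferInstance⟩)

theorem isAddHaarMeasure_volume_params (n R M C : ℕ) :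
    BorelSpace (Params n R M C) ∧ (volume : Measure (Params n R M C)).IsAddHaarMeasure :=
  isAddHaarMeasure_volume_prod (isAddHaarMeasure_volume_pi_pi _ _) <|
    isAddHaarMeasure_volume_prod
      (isAddHaarMeasure_volume_pi _ (isAddHaarMeasure_volume_pi_pi _ _)) <|
    isAddHaarMeasure_volume_prod
      (isAddHaarMeasure_volume_pi _ (isAddHaarMeasure_volume_pi_pi _ _)) <|
    isAddHaarMeasure_volume_prod (isAddHaarMeasure_volume_pi_pi _ _)
      (isAddHaarMeasure_volume_pi_pi _ _)

/-- If, for one choice of the parameters, some square matrix of values of the score is nonsingular,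
then its size bounds the separation rank from below for almost all parameters. -/
theorem ae_card_le_sepRankIn {X ι : Type*} [Fintype ι] [DecidableEq ι] {k : ℕ}
    (f : Fin M → X → ℝ) (c : Fin C) (xs xe : ι → Fin k → X) (θ₀ : Params n R M C)
    (h : (Matrix.of fun i j => score f θ₀ c (Fin.append (xs i) (xe j))).det ≠ 0) :
    ∀ᵐ θ : Params n R M C, ∀ P : ((Fin k → X) → ℝ) → Prop,
      (Fintype.card ι : ℕ∞) ≤ sepRankIn P (score f θ c) := by
  obtain ⟨_, _⟩ := isAddHaarMeasure_volume_params n R M C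
  have := ae_ne_zero_of_analyticAt (volume : Measure (Params n R M C))
    (fun θ => analyticAt_det (A := fun θ : Params n R M C =>
      Matrix.of fun i j => score f θ c (Fin.append (xs i) (xe j)))
      fun i j => analyticAt_score f c _ θ) h
  filter_upwards [this] with θ hθ P
  exact card_le_sepRankIn P _ xs xe hθ

end Analytic

/-! ### Transfer matrices of a recurrent layer. -/

section Transfer

open Matrix

variable {ι κ ρ σ : Type*} [Fintype ρ] [DecidableEq ρ] [Fintype σ] [DecidableEq σ]

/-- The linear map by which a recurrent layer with hidden weights `W` transforms its state while
reading a list of inputs, the input `j` acting by element-wise multiplication with `V j`. -/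
noncomputable def transfer (V : ι → ρ → ℝ) (W : Matrix ρ ρ ℝ) : List ι → Matrix ρ ρ ℝ
  | [] => 1
  | j :: l => transfer V W l * (diagonal (V j) * W)

@[simp]
theorem transfer_nil (V : ι → ρ → ℝ) (W : Matrix ρ ρ ℝ) : transfer V W [] = 1 := rfl

@[simp]
theorem transfer_cons (V : ι → ρ → ℝ) (W : Matrix ρ ρ ℝ) (j : ι) (l : List ι) :
    transfer V W (j :: l) = transfer V W l * (diagonal (V j) * W) := rfl

theorem transfer_append (V : ι → ρ → ℝ) (W : Matrix ρ ρ ℝ) (l l' : List ι) :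
    transfer V W (l ++ l') = transfer V W l' * transfer V W l := by
  induction l with
  | nil => simp
  | cons j l ih => simp [ih, Matrix.mul_assoc]

theorem transfer_concat (V : ι → ρ → ℝ) (W : Matrix ρ ρ ℝ) (l : List ι) (j : ι) :
    transfer V W (l ++ [j]) = diagonal (V j) * W * transfer V W l := by
  simp [transfer_append]

theorem transfer_map (V : ι → ρ → ℝ) (W : Matrix ρ ρ ℝ) (g : κ → ι) (l : List κ) :
    transfer V W (l.map g) = transfer (fun j => V (g j)) W l := by
  induction l with
  | nil => rfl
  | cons j l ih => simp [ih]

/-- Transposition reverses the alternating product of diagonals and copies of `W`. The extra `Wᵀ`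
shifts the bracketing, so that the factors again have the form diagonal times `Wᵀ`. -/
theorem transfer_reverse_transpose (V : ι → ρ → ℝ) (W : Matrix ρ ρ ℝ) (l : List ι) :
    (transfer V W l.reverse)ᵀ * Wᵀ = Wᵀ * transfer V Wᵀ l := by
  induction l with
  | nil => simp
  | cons j l ih =>
    rw [List.reverse_cons, transfer_concat, transfer_cons, transpose_mul, transpose_mul,
      diagonal_transpose, ← Matrix.mul_assoc, ih]
    simp only [Matrix.mul_assoc]

/-- A network on fewer channels, embedded by a matrix `J` with orthonormal columns. -/
theorem transfer_mul_embedding (J : Matrix σ ρ ℝ) (hJ : Jᵀ * J = 1) (V' : ι → σ → ℝ)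
    (V : ι → ρ → ℝ) (hV : ∀ j, diagonal (V' j) * J = J * diagonal (V j)) (W : Matrix ρ ρ ℝ)
    (l : List ι) :
    transfer V' (J * W * Jᵀ) l * J = J * transfer V W l := by
  induction l with
  | nil => simp
  | cons j l ih =>
    have h : diagonal (V' j) * (J * W * Jᵀ) * J = J * (diagonal (V j) * W) := by
      calc diagonal (V' j) * (J * W * Jᵀ) * J = diagonal (V' j) * J * W * (Jᵀ * J) := by
            simp only [Matrix.mul_assoc]
        _ = J * (diagonal (V j) * W) := by rw [hJ, hV, Matrix.mul_one, Matrix.mul_assoc]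
    rw [transfer_cons, transfer_cons, Matrix.mul_assoc, h, ← Matrix.mul_assoc, ih,
      Matrix.mul_assoc]

theorem analyticAt_transfer {E : Type*} [NormedAddCommGroup E] [NormedSpace ℝ E]
    (V : ι → ρ → ℝ) {W : E → Matrix ρ ρ ℝ} {z : E}
    (hW : ∀ r s, AnalyticAt ℝ (fun w => W w r s) z) (l : List ι) (r s : ρ) :
    AnalyticAt ℝ (fun w => transfer V (W w) l r s) z := by
  induction l generalizing r s with
  | nil => exact analyticAt_const
  | cons j l ih =>
    simp only [transfer_cons, Matrix.mul_apply (M := transfer V _ l), diagonal_mul]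
    exact Finset.analyticAt_fun_sum _ fun q _ => (ih r q).mul (analyticAt_const.mul (hW q s))

end Transfer

/-! ### Depth 1: upper bound. -/

section SingleLayer

open Matrix

variable {n R M C : ℕ} {X : Type*}

/-- The bottom layer receives nothing from the layers above, so its evolution is linear in its
initial state at any depth. -/
theorem hidden_zero_eq_transfer (f : Fin M → X → ℝ) (θ : Params n R M C) (t : ℕ)
    (x : Fin t → X) :
    hidden f θ t x 0 =
      transfer (fun z => inputWeights θ *ᵥ fun d => f d z) (hiddenWeights θ 0) (List.ofFn x) *ᵥ
        initialState θ 0 := by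
  induction t with
  | zero => simp [hidden]
  | succ t ih =>
    rw [List.ofFn_succ_last, transfer_concat, ← mulVec_mulVec, ← mulVec_mulVec]
    have := ih (Fin.init x)
    simp only [hidden, step, Fin.induction_zero, this]
    ext r
    simp [mulVec_diagonal, mul_comm, Fin.init_def]

theorem score_append_eq (f : Fin M → X → ℝ) (θ : Params 0 R M C) (c : Fin C) {s t : ℕ}
    (xs : Fin s → X) (xe : Fin t → X) :
    score f θ c (Fin.append xs xe) =
      outputWeights θ c ⬝ᵥ
        (transfer (fun z => inputWeights θ *ᵥ fun d => f d z) (hiddenWeights θ 0)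
            (List.ofFn xe) *ᵥ
          transfer (fun z => inputWeights θ *ᵥ fun d => f d z) (hiddenWeights θ 0)
            (List.ofFn xs) *ᵥ initialState θ 0) := by
  have : Fin.last 0 = 0 := rfl
  rw [score, this, hidden_zero_eq_transfer, List.ofFn_fin_append, transfer_append, ← mulVec_mulVec]
  rfl

/-- The span of the products of one initial mapping function for each input. -/
noncomputable def productSpan (f : Fin M → X → ℝ) (t : ℕ) : Submodule ℝ ((Fin t → X) → ℝ) :=
  Submodule.span ℝ (Set.range fun (w : Fin t → Fin M) (x : Fin t → X) => ∏ s, f (w s) (x s))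

theorem mul_mem_productSpan (f : Fin M → X → ℝ) {t : ℕ} {g : (Fin t → X) → ℝ}
    (hg : g ∈ productSpan f t) (d : Fin M) :
    (fun x : Fin (t + 1) → X => g (Fin.tail x) * f d (x 0)) ∈ productSpan f (t + 1) := by
  induction hg using Submodule.span_induction with
  | mem g hg =>
    obtain ⟨w, rfl⟩ := hg
    refine Submodule.subset_span ⟨Fin.cons d w, ?_⟩
    ext x
    simp [Fin.prod_univ_succ, Fin.tail, mul_comm]
  | zero => simpa only [Pi.zero_apply, zero_mul] using! (productSpan f (t + 1)).zero_mem
  | add g h _ _ hg hh => simpa [add_mul] using! (productSpan f (t + 1)).add_mem hg hh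
  | smul a g _ hg => simpa [mul_assoc] using! (productSpan f (t + 1)).smul_mem a hg

/-- Each input enters through exactly one diagonal factor, linearly in `f`; the first input is the
rightmost factor and is peeled off. -/
theorem transfer_mem_productSpan (f : Fin M → X → ℝ) (U : Matrix (Fin R) (Fin M) ℝ)
    (W : Matrix (Fin R) (Fin R) ℝ) (t : ℕ) (r s : Fin R) :
    (fun x : Fin t → X => transfer (fun z => U *ᵥ fun d => f d z) W (List.ofFn x) r s) ∈
      productSpan f t := by
  induction t generalizing r s with
  | zero =>
    have : (fun x : Fin 0 → X =>
        transfer (fun z => U *ᵥ fun d => f d z) W (List.ofFn x) r s) =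
        (1 : Matrix (Fin R) (Fin R) ℝ) r s •
          fun x : Fin 0 → X => ∏ i, f ((Fin.elim0 : Fin 0 → Fin M) i) (x i) := by
      ext x; simp
    rw [this]
    exact Submodule.smul_mem _ _ (Submodule.subset_span ⟨_, rfl⟩)
  | succ t ih =>
    have : (fun x : Fin (t + 1) → X =>
        transfer (fun z => U *ᵥ fun d => f d z) W (List.ofFn x) r s) =
        ∑ q, ∑ d, (U q d * W q s) • fun x : Fin (t + 1) → X =>
          transfer (fun z => U *ᵥ fun d => f d z) W (List.ofFn (Fin.tail x)) r q * f d (x 0) := by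
      ext x
      rw [List.ofFn_succ, transfer_cons, Matrix.mul_apply]
      simp only [diagonal_mul, mulVec, dotProduct, Finset.sum_apply, Pi.smul_apply, smul_eq_mul,
        Finset.sum_mul, Finset.mul_sum]
      refine Finset.sum_congr rfl fun q _ => Finset.sum_congr rfl fun d _ => ?_
      simp only [Fin.tail_def]
      ring
    rw [this]
    exact Submodule.sum_mem _ fun q _ => Submodule.sum_mem _ fun d _ =>
      Submodule.smul_mem _ _ (mul_mem_productSpan f (ih r q) d)

theorem memLp_of_mem_productSpan [MeasurableSpace X] {μ : Measure X} [SigmaFinite μ]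
    {f : Fin M → X → ℝ} (hf : ∀ d, MemLp (f d) 2 μ) {t : ℕ} {g : (Fin t → X) → ℝ}
    (hg : g ∈ productSpan f t) : MemLp g 2 (Measure.pi fun _ : Fin t => μ) := by
  induction hg using Submodule.span_induction with
  | mem g hg =>
    obtain ⟨w, rfl⟩ := hg
    have hmeas : AEStronglyMeasurable (fun x : Fin t → X => ∏ s, f (w s) (x s))
        (Measure.pi fun _ : Fin t => μ) :=
      Finset.aestronglyMeasurable_fun_prod _ fun s _ =>
        (hf (w s)).1.comp_quasiMeasurePreserving (Measure.quasiMeasurePreserving_eval _ s)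
    refine (memLp_two_iff_integrable_sq hmeas).2 ?_
    simp only [← Finset.prod_pow]
    exact Integrable.fintype_prod (μ := fun _ : Fin t => μ) (f := fun s z => f (w s) z ^ 2)
      fun s => (hf (w s)).integrable_sq
  | zero => exact MemLp.zero
  | add g h _ _ hg hh => exact hg.add hh
  | smul a g _ hg => exact hg.const_smul a

theorem sepRankL2_le [MeasurableSpace X] (μ : Measure X) [SigmaFinite μ]
    (f : Fin M → X → ℝ) (hf : ∀ d, MemLp (f d) 2 μ) (θ : Params 0 R M C) (c : Fin C) (k : ℕ) :
    sepRankL2 μ (k := k) (score f θ c) ≤ (min R (M ^ k) : ℕ) := by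
  let A := transfer (fun z => inputWeights θ *ᵥ fun d => f d z) (hiddenWeights θ 0)
  let gs : Fin R → (Fin k → X) → ℝ := fun r x => (A (List.ofFn x) *ᵥ initialState θ 0) r
  let ge : Fin R → (Fin k → X) → ℝ := fun r x => (outputWeights θ c ᵥ* A (List.ofFn x)) r
  have hA : ∀ r s, (fun x : Fin k → X => A (List.ofFn x) r s) ∈ productSpan f k :=
    transfer_mem_productSpan f _ _ k
  have hgs : ∀ r, gs r ∈ productSpan f k := by
    intro r
    have : gs r = ∑ s, initialState θ 0 s • fun x : Fin k → X => A (List.ofFn x) r s := by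
      ext x; simp [gs, mulVec, dotProduct, mul_comm]
    rw [this]
    exact Submodule.sum_mem _ fun s _ => Submodule.smul_mem _ _ (hA r s)
  have hge : ∀ r, ge r ∈ productSpan f k := by
    intro r
    have : ge r = ∑ s, outputWeights θ c s • fun x : Fin k → X => A (List.ofFn x) s r := by
      ext x; simp [ge, vecMul, dotProduct]
    rw [this]
    exact Submodule.sum_mem _ fun s _ => Submodule.smul_mem _ _ (hA s r)
  have hy : ∀ xs xe : Fin k → X, score f θ c (Fin.append xs xe) = ∑ r, gs r xs * ge r xe := by
    intro xs xe
    rw [score_append_eq, dotProduct_mulVec]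
    simp [dotProduct, gs, ge, A, mul_comm]
  rcases min_choice R (M ^ k) with h | h <;> rw [h]
  · exact sInf_le ⟨R, rfl, gs, ge, fun r => memLp_of_mem_productSpan hf (hgs r),
      fun r => memLp_of_mem_productSpan hf (hge r), hy⟩
  -- Expanding every start factor in the `M ^ k` products and collecting terms leaves one end factor
  -- per product.
  · choose a ha using fun r => (Submodule.mem_span_range_iff_exists_fun ℝ).1 (hgs r)
    let e : (Fin k → Fin M) ≃ Fin (M ^ k) := finFunctionFinEquiv
    refine sInf_le ⟨M ^ k, rfl, fun ν x => ∏ s, f (e.symm ν s) (x s),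
      fun ν => ∑ r, a r (e.symm ν) • ge r, fun ν => ?_, fun ν => ?_, fun xs xe => ?_⟩
    · exact memLp_of_mem_productSpan hf (Submodule.subset_span ⟨_, rfl⟩)
    · exact memLp_of_mem_productSpan hf
        (Submodule.sum_mem _ fun r _ => Submodule.smul_mem _ _ (hge r))
    · rw [hy, e.symm.sum_comp fun w => (∏ s, f (w s) (xs s)) * (∑ r, a r w • ge r) xe]
      simp only [← ha, Finset.sum_apply, Pi.smul_apply, smul_eq_mul, Finset.sum_mul,
        Finset.mul_sum]
      rw [Finset.sum_comm]
      exact Finset.sum_congr rfl fun w _ => Finset.sum_congr rfl fun r _ => by ring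

end SingleLayer

/-! ### Depth 1: lower bound. -/

section SingleLayerLowerBound

open Matrix

theorem exists_inputWeights {X : Type*} {R M : ℕ} {f : Fin M → X → ℝ} {x : Fin M → X}
    (hx : (Matrix.of fun i j => f i (x j)).det ≠ 0) (V : Fin M → Fin R → ℝ) :
    ∃ U : Matrix (Fin R) (Fin M) ℝ, ∀ j, (U *ᵥ fun d => f d (x j)) = V j := by
  refine ⟨(Matrix.of V)ᵀ * (Matrix.of fun i j => f i (x j))⁻¹, fun j => ?_⟩
  have h : (Matrix.of V)ᵀ * (Matrix.of fun i j => f i (x j))⁻¹ *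
      (Matrix.of fun i j => f i (x j)) = (Matrix.of V)ᵀ := by
    rw [Matrix.mul_assoc, Matrix.nonsing_inv_mul _ (isUnit_iff_ne_zero.2 hx), Matrix.mul_one]
  ext r
  exact congrFun (congrFun h r) j

/-- Channel `r` is open exactly for the letter which is the last digit of `r` in base `M`. -/
noncomputable def digitInput (M N : ℕ) (j : Fin M) (r : Fin N) : ℝ :=
  if (r : ℕ) % M = j then 1 else 0

/-- Channel `r` reads the channel obtained by deleting the last digit of `r` in base `M`. -/
noncomputable def digitShift (M N : ℕ) : Matrix (Fin N) (Fin N) ℝ :=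
  Matrix.of fun r s => if (s : ℕ) = r / M then 1 else 0

/-- The state concentrated in channel `0`. -/
noncomputable def originState (N : ℕ) (r : Fin N) : ℝ := if (r : ℕ) = 0 then 1 else 0

/-- The word lists the `k` base-`M` digits of `i`, most significant first. From channel `i / M` the
shift reaches all `r` with `r / M = i / M`, and the last letter keeps only `r = i`. Leading zeros
stay in channel `0`, and prefixes never exceed `i`, so `N` channels suffice. -/
theorem exists_word_transfer_eq_single (M N k : ℕ) (i : Fin N) (hi : (i : ℕ) < M ^ k) :
    ∃ w : Fin k → Fin M,
      transfer (digitInput M N) (digitShift M N) (List.ofFn w) *ᵥ originState N =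
        Pi.single i 1 := by
  induction k generalizing i with
  | zero =>
    refine ⟨Fin.elim0, ?_⟩
    have : (i : ℕ) = 0 := by simpa using hi
    ext r
    simp [originState, Pi.single_apply, Fin.ext_iff, this]
  | succ k ih =>
    have hM : 0 < M := by
      rcases Nat.eq_zero_or_pos M with rfl | h
      · simp at hi
      · exact h
    obtain ⟨w, hw⟩ := ih ⟨i / M, (Nat.div_le_self _ _).trans_lt i.2⟩
      (Nat.div_lt_of_lt_mul (by simpa [pow_succ'] using hi))
    refine ⟨Fin.snoc w ⟨i % M, Nat.mod_lt _ hM⟩, ?_⟩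
    rw [List.ofFn_succ_last, transfer_concat, ← mulVec_mulVec]
    simp only [Fin.snoc_castSucc, Fin.snoc_last]
    rw [hw, ← mulVec_mulVec]
    ext r
    rw [mulVec_diagonal]
    simp only [mulVec_single_one, digitInput, digitShift, Pi.single_apply, Matrix.col_apply,
      Matrix.of_apply]
    rw [ite_zero_mul_ite_zero]
    simp only [mul_one]
    refine if_congr ⟨fun ⟨h1, h2⟩ => ?_, fun h => by simp [h]⟩ rfl rfl
    rw [Fin.ext_iff, ← Nat.div_add_mod (r : ℕ) M, ← Nat.div_add_mod (i : ℕ) M, h1, h2]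

/-- There are hidden weights for which the states reached on `N` suitable words are independent,
both for the layer and for the layer run backwards. -/
theorem exists_det_transfer_ne_zero (M N k : ℕ) (hN : N ≤ M ^ k) :
    ∃ (w : Fin N → Fin k → Fin M) (W : Matrix (Fin N) (Fin N) ℝ),
      (Matrix.of fun i j => (Wᵀ *ᵥ originState N) ⬝ᵥ
        (transfer (digitInput M N) W (List.ofFn (w j)).reverse *ᵥ
          transfer (digitInput M N) W (List.ofFn (w i)) *ᵥ originState N)).det ≠ 0 := by
  choose w hw using fun i : Fin N => exists_word_transfer_eq_single M N k i (i.2.trans_le hN)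
  let S : Matrix (Fin N) (Fin N) ℝ → Matrix (Fin N) (Fin N) ℝ := fun W =>
    Matrix.of fun i => transfer (digitInput M N) W (List.ofFn (w i)) *ᵥ originState N
  have hS : S (digitShift M N) = 1 := by
    ext i r
    simp [S, hw, Matrix.one_apply, Pi.single_apply, eq_comm]
  obtain ⟨_, _⟩ := isAddHaarMeasure_volume_pi_pi N N
  have hSan : ∀ (g : (Fin N → Fin N → ℝ) → Matrix (Fin N) (Fin N) ℝ) (W₀ : Fin N → Fin N → ℝ),
      (∀ r s, AnalyticAt ℝ (fun W => g W r s) W₀) →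
      AnalyticAt ℝ (fun W => (S (g W)).det) W₀ := by
    intro g W₀ hg
    refine analyticAt_det fun i r => ?_
    simp only [S, Matrix.of_apply, mulVec, dotProduct]
    exact Finset.analyticAt_fun_sum _ fun s _ =>
      (analyticAt_transfer _ hg _ _ _).mul analyticAt_const
  -- The three generic conditions have different witnesses: the shift, its transpose and the
  -- identity.
  have h1 : ∀ᵐ W : Fin N → Fin N → ℝ, (S (Matrix.of W)).det ≠ 0 :=
    ae_ne_zero_of_analyticAt volume (fun W₀ => hSan _ W₀ fun r s => analyticAt_entry r s W₀)
      (p := digitShift M N) (by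
        rw [show Matrix.of (digitShift M N) = digitShift M N from rfl, hS]; simp)
  have h2 : ∀ᵐ W : Fin N → Fin N → ℝ, (S (Matrix.of W)ᵀ).det ≠ 0 :=
    ae_ne_zero_of_analyticAt volume (fun W₀ => hSan _ W₀ fun r s => analyticAt_entry s r W₀)
      (p := (digitShift M N)ᵀ) (by
        rw [show (Matrix.of (digitShift M N)ᵀ)ᵀ = digitShift M N from rfl, hS]; simp)
  have h3 : ∀ᵐ W : Fin N → Fin N → ℝ, (Matrix.of W).det ≠ 0 :=
    ae_ne_zero_of_analyticAt volume (fun W₀ => analyticAt_det fun r s => analyticAt_entry r s W₀)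
      (p := (1 : Matrix (Fin N) (Fin N) ℝ)) (by
        rw [show Matrix.of (1 : Matrix (Fin N) (Fin N) ℝ) = 1 from rfl]; simp)
  obtain ⟨W, ⟨hW1, hW2⟩, hW3⟩ := ((h1.and h2).and h3).exists
  refine ⟨w, Matrix.of W, ?_⟩
  have : (Matrix.of fun i j => ((Matrix.of W)ᵀ *ᵥ originState N) ⬝ᵥ
        (transfer (digitInput M N) (Matrix.of W) (List.ofFn (w j)).reverse *ᵥ
          transfer (digitInput M N) (Matrix.of W) (List.ofFn (w i)) *ᵥ originState N)) =
      S (Matrix.of W) * ((Matrix.of W)ᵀ * (S (Matrix.of W)ᵀ)ᵀ) := by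
    ext i j
    rw [Matrix.of_apply, dotProduct_mulVec, ← mulVec_transpose, mulVec_mulVec,
      transfer_reverse_transpose, ← mulVec_mulVec, dotProduct_comm]
    rfl
  rw [this, det_mul, det_mul, det_transpose, det_transpose]
  exact mul_ne_zero hW1 (mul_ne_zero hW3 hW2)

/-- The inclusion of the first `N` channels. -/
noncomputable def channelInclusion (R N : ℕ) : Matrix (Fin R) (Fin N) ℝ :=
  Matrix.of fun r i => if (r : ℕ) = i then 1 else 0

theorem channelInclusion_transpose_mul {R N : ℕ} (h : N ≤ R) :
    (channelInclusion R N)ᵀ * channelInclusion R N = 1 := by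
  ext i j
  rw [Matrix.mul_apply, Finset.sum_eq_single (Fin.castLE h i)]
  · simp [channelInclusion, Matrix.one_apply, Fin.ext_iff]
  · intro r _ hr
    have : (r : ℕ) ≠ i := fun h' => hr (Fin.ext h')
    simp [channelInclusion, this]
  · simp

theorem diagonal_mul_channelInclusion {R N : ℕ} (v : Fin N → ℝ) :
    diagonal (channelInclusion R N *ᵥ v) * channelInclusion R N =
      channelInclusion R N * diagonal v := by
  ext r i
  rw [diagonal_mul, mul_diagonal]
  by_cases hr : (r : ℕ) = i
  · have : (channelInclusion R N *ᵥ v) r = v i := by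
      rw [mulVec, dotProduct, Finset.sum_eq_single i]
      · simp [channelInclusion, hr]
      · intro j _ hj
        have : (r : ℕ) ≠ j := fun h' => hj (Fin.ext (h'.symm.trans hr))
        simp [channelInclusion, this]
      · simp
    rw [this, mul_comm]
  · simp [channelInclusion, hr]

theorem ae_le_sepRankIn_single {X : Type*} {R M C : ℕ} (k : ℕ) {f : Fin M → X → ℝ}
    (hf : LinearIndependent ℝ f) (c : Fin C) :
    ∀ᵐ θ : Params 0 R M C, ∀ P : ((Fin k → X) → ℝ) → Prop,
      ((min R (M ^ k) : ℕ) : ℕ∞) ≤ sepRankIn P (score f θ c) := by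
  obtain ⟨x, hx⟩ := exists_points_det_ne_zero hf
  set N := min R (M ^ k) with hN
  have hNR : N ≤ R := min_le_left _ _
  obtain ⟨w, W, hdet⟩ := exists_det_transfer_ne_zero M N k (min_le_right _ _)
  set J := channelInclusion R N with hJ
  obtain ⟨U, hU⟩ := exists_inputWeights hx fun j => J *ᵥ digitInput M N j
  -- The `N`-channel network is placed in the first `N` of the `R` channels, and the end words are
  -- sampled in reverse order.
  let θ₀ : Params 0 R M C := (U, Fin.elim0, fun _ => J * W * Jᵀ,
    fun _ => J *ᵥ (Wᵀ *ᵥ originState N), fun _ => J *ᵥ originState N)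
  have hJJ : Jᵀ * J = 1 := channelInclusion_transpose_mul hNR
  have key := ae_card_le_sepRankIn f c (fun i s => x (w i s)) (fun i s => x (w i (Fin.rev s))) θ₀
  rw [Fintype.card_fin] at key
  refine key ?_
  convert hdet using 3
  ext i j
  have hin : (fun z => inputWeights θ₀ *ᵥ fun d => f d (x z)) =
      fun z => J *ᵥ digitInput M N z := funext hU
  have hrev : (List.ofFn fun s => x (w j (Fin.rev s))) = ((List.ofFn (w j)).reverse).map x := by
    refine List.ext_getElem (by simp) fun s h₁ h₂ => ?_
    simp only [List.getElem_ofFn, List.getElem_map, List.getElem_reverse, List.length_ofFn]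
    congr 2
    rw [Fin.ext_iff, Fin.val_rev]
    simp only
    omega
  have hrun : ∀ (l : List (Fin M)) (v : Fin N → ℝ),
      transfer (fun z => inputWeights θ₀ *ᵥ fun d => f d z) (hiddenWeights θ₀ 0) (l.map x) *ᵥ
        (J *ᵥ v) = J *ᵥ (transfer (digitInput M N) W l *ᵥ v) := by
    intro l v
    rw [transfer_map, hin, mulVec_mulVec, mulVec_mulVec]
    exact congrArg (· *ᵥ v) (transfer_mul_embedding J hJJ _ _
      (fun j => diagonal_mul_channelInclusion _) W l)
  rw [score_append_eq, hrev, show (List.ofFn fun s => x (w i s)) = (List.ofFn (w i)).map x by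
    rw [List.map_ofFn]; rfl]
  change (J *ᵥ (Wᵀ *ᵥ originState N)) ⬝ᵥ (_ *ᵥ (_ *ᵥ (J *ᵥ originState N))) = _
  rw [hrun, hrun, dotProduct_mulVec, ← mulVec_transpose, mulVec_mulVec _ Jᵀ J, hJJ, one_mulVec]

end SingleLayerLowerBound

/-! ### Depth 2: a summing network and its score. -/

section TwoLayers

open Matrix

variable {m k : ℕ}

/-- The product of the weights `v (d s) r` over the times `s` up to `τ`. -/
noncomputable def partialProd {t : ℕ} (v : Fin m → Fin m → ℝ) (d : Fin t → Fin m) (τ : Fin t)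
    (r : Fin m) : ℝ :=
  ∏ s, if s ≤ τ then v (d s) r else 1

theorem sum_fin_indicator_mul {R : ℕ} (h : m ≤ R) (g : Fin R → ℝ) :
    ∑ r : Fin R, (if (r : ℕ) < m then (1 : ℝ) else 0) * g r = ∑ r : Fin m, g (Fin.castLE h r) := by
  obtain ⟨q, rfl⟩ := Nat.exists_eq_add_of_le h
  rw [Fin.sum_univ_add]
  simp
  rfl

/-- Parameters of a two-layer network: identity hidden weights, all initial states and output
weights equal to `1`, and a second layer that sums the first `m` channels. -/
noncomputable def summingParams {R M : ℕ} (C m : ℕ) (U : Matrix (Fin R) (Fin M) ℝ) :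
    Params 1 R M C :=
  (U, fun _ _ r => if (r : ℕ) < m then 1 else 0, fun _ => (1 : Matrix (Fin R) (Fin R) ℝ),
    fun _ _ => 1, fun _ _ => 1)

variable {X : Type*} {R M C : ℕ}

/-- Identity hidden weights make each layer multiply up what it receives: the first accumulates
inputs, the second accumulates the sums of first-layer states. -/
theorem hidden_summingParams (f : Fin M → X → ℝ) (hmR : m ≤ R) (U : Matrix (Fin R) (Fin M) ℝ)
    (p : Fin m → X) (v : Fin m → Fin m → ℝ)
    (hU : ∀ j r, (U *ᵥ fun d => f d (p j)) (Fin.castLE hmR r) = v j r) {t : ℕ}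
    (d : Fin t → Fin m) :
    (∀ r, hidden f (summingParams C m U) t (fun s => p (d s)) 0 (Fin.castLE hmR r) =
        ∏ s, v (d s) r) ∧
      ∀ i, hidden f (summingParams C m U) t (fun s => p (d s)) 1 i =
        ∏ τ, ∑ r, partialProd v d τ r := by
  induction t with
  | zero => exact ⟨fun r => by simp [hidden, initialState, summingParams],
      fun i => by simp [hidden, initialState, summingParams]⟩
  | succ t ih =>
    obtain ⟨ih0, ih1⟩ := ih (fun s => d s.castSucc)
    have hW : ∀ l, hiddenWeights (summingParams C m U) l = 1 := fun l => rfl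
    have h0 : ∀ r, hidden f (summingParams C m U) (t + 1) (fun s => p (d s)) 0
        (Fin.castLE hmR r) = ∏ s, v (d s) r := by
      intro r
      simp only [hidden, step, Fin.induction_zero, Pi.mul_apply, hW, one_mulVec, Fin.init_def]
      rw [ih0, Fin.prod_univ_castSucc, ← hU]
      rfl
    refine ⟨h0, fun i => ?_⟩
    have h1 : hidden f (summingParams C m U) (t + 1) (fun s => p (d s)) 1 i =
        hidden f (summingParams C m U) t (fun s => p (d s.castSucc)) 1 i *
          ∑ r : Fin R, (if (r : ℕ) < m then (1 : ℝ) else 0) *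
            hidden f (summingParams C m U) (t + 1) (fun s => p (d s)) 0 r := by
      change ((hiddenWeights (summingParams C m U) 1) *ᵥ _) i * _ = _
      rw [hW, one_mulVec]
      rfl
    rw [h1, ih1, sum_fin_indicator_mul hmR, Fin.prod_univ_castSucc]
    congr 1
    · refine Finset.prod_congr rfl fun τ _ => Finset.sum_congr rfl fun r _ => ?_
      simp only [partialProd]
      rw [Fin.prod_univ_castSucc]
      simp [Fin.castSucc_le_castSucc_iff, (Fin.castSucc_lt_last τ).not_ge]
    · refine Finset.sum_congr rfl fun r _ => ?_
      rw [h0]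
      simp [partialProd, Fin.le_last]

theorem score_summingParams_append (f : Fin M → X → ℝ) (hmR : m ≤ R)
    (U : Matrix (Fin R) (Fin M) ℝ) (p : Fin m → X) (v : Fin m → Fin m → ℝ)
    (hU : ∀ j r, (U *ᵥ fun d => f d (p j)) (Fin.castLE hmR r) = v j r) (c : Fin C)
    (d e : Fin k → Fin m) :
    score f (summingParams C m U) c (Fin.append (fun s => p (d s)) (fun s => p (e s))) =
      R * ((∏ τ, ∑ r, partialProd v d τ r) *
        ∏ τ, ∑ r, (∏ s, v (d s) r) * partialProd v e τ r) := by
  have happ : Fin.append (fun s => p (d s)) (fun s => p (e s)) =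
      fun s => p (Fin.append d e s) := by
    ext s
    refine Fin.addCases (fun i => ?_) (fun i => ?_) s
    · rw [Fin.append_left, Fin.append_left]
    · rw [Fin.append_right, Fin.append_right]
  have hlast : Fin.last 1 = 1 := rfl
  have hO : outputWeights (summingParams C m U) c = fun _ => 1 := rfl
  have h1 := (hidden_summingParams (C := C) f hmR U p v hU (Fin.append d e)).2
  rw [score, happ, hlast, mulVec, dotProduct, hO]
  simp only [h1, one_mul, Finset.sum_const, Finset.card_univ, Fintype.card_fin, nsmul_eq_mul]
  rw [Fin.prod_univ_add]
  congr 2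
  · refine Finset.prod_congr rfl fun τ _ => Finset.sum_congr rfl fun r _ => ?_
    simp only [partialProd]
    rw [Fin.prod_univ_add]
    have : ∀ s : Fin k, ¬ k + (s : ℕ) ≤ τ := fun s => by omega
    simp only [Fin.le_def, Fin.val_castAdd, Fin.val_natAdd, this, Fin.append_left, if_false,
      Finset.prod_const_one, mul_one]
  · refine Finset.prod_congr rfl fun τ _ => Finset.sum_congr rfl fun r _ => ?_
    simp only [partialProd]
    rw [Fin.prod_univ_add]
    have : ∀ s : Fin k, (s : ℕ) ≤ k + τ := fun s => s.2.le.trans (Nat.le_add_right _ _)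
    simp only [Fin.le_def, Fin.val_castAdd, Fin.val_natAdd, this, Fin.append_left,
      Fin.append_right, if_true, Nat.add_le_add_iff_left]

/-! ### Depth 2: monomials, their values and their coefficients. -/

/-- The multiset of values of a tuple. -/
def symOf (ρ : Fin k → Fin m) : Sym (Fin m) k :=
  ⟨Finset.univ.val.map ρ, by simp⟩

theorem exists_monotone_symOf_eq (e : Sym (Fin m) k) :
    ∃ w : Fin k → Fin m, Monotone w ∧ symOf w = e := by
  obtain ⟨s, hs⟩ := e
  have hl : (s.sort (· ≤ ·)).length = k := by rw [Multiset.length_sort, hs]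
  refine ⟨fun i => (s.sort (· ≤ ·)).get (Fin.cast hl.symm i), fun i j hij => ?_,
    Subtype.ext ?_⟩
  · exact (Multiset.pairwise_sort s (· ≤ ·)).rel_get_of_le hij
  · simp only [symOf]
    rw [Fin.univ_val_map, ← List.ofFn_congr hl, List.ofFn_get, Multiset.sort_eq]

theorem prod_eq_of_symOf_eq {ρ ρ' : Fin k → Fin m} (h : symOf ρ = symOf ρ') {β : Type*}
    [CommMonoid β] (a : Fin m → β) : ∏ τ, a (ρ τ) = ∏ τ, a (ρ' τ) := by
  have h' : Finset.univ.val.map ρ = Finset.univ.val.map ρ' := congrArg Subtype.val h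
  have := congrArg (fun s => (s.map a).prod) h'
  simp only [Multiset.map_map] at this
  exact this

/-- The coefficient of the monomial `n` in the product over the times `τ` of the linear forms with
coefficients `partialProd v e τ`. -/
noncomputable def formCoeff (v : Fin m → Fin m → ℝ) (n : Sym (Fin m) k) (e : Fin k → Fin m) : ℝ :=
  ∑ ρ : Fin k → Fin m with symOf ρ = n, ∏ τ, partialProd v e τ (ρ τ)

theorem prod_sum_eq_sum_formCoeff (v : Fin m → Fin m → ℝ) (a : Fin m → ℝ) (e : Fin k → Fin m)
    (w : Sym (Fin m) k → Fin k → Fin m) (hw : ∀ n, symOf (w n) = n) :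
    ∏ τ, ∑ r, a r * partialProd v e τ r = ∑ n, (∏ τ, a (w n τ)) * formCoeff v n e := by
  rw [Finset.prod_univ_sum, Fintype.piFinset_univ, ← Finset.sum_fiberwise _ symOf]
  refine Finset.sum_congr rfl fun n _ => ?_
  rw [formCoeff, Finset.mul_sum]
  refine Finset.sum_congr rfl fun ρ hρ => ?_
  rw [Finset.prod_mul_distrib,
    prod_eq_of_symOf_eq (((Finset.mem_filter.1 hρ).2).trans (hw n).symm) a]

/-- A matrix with unit diagonal whose entries vanish unless a weight strictly increases. -/
theorem det_eq_one_of_weight {ι : Type*} [Fintype ι] [DecidableEq ι] (A : Matrix ι ι ℝ)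
    (b : ι → ℕ) (hdiag : ∀ i, A i i = 1) (hoff : ∀ i j, i ≠ j → A i j ≠ 0 → b j < b i) :
    A.det = 1 := by
  have hb : BlockTriangular Aᵀ b := fun i j hij => by
    by_contra h
    rw [transpose_apply] at h
    have hne : j ≠ i := by rintro rfl; exact lt_irrefl _ hij
    exact absurd (hoff j i hne h) (by omega)
  rw [← det_transpose, hb.det]
  refine Finset.prod_eq_one fun a _ => ?_
  rw [show toSquareBlock Aᵀ b a = 1 from ?_, det_one]
  ext i j
  rw [toSquareBlock_def, Matrix.of_apply, transpose_apply, one_apply]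
  split_ifs with h
  · rw [h, hdiag]
  · by_contra h'
    have := hoff j i (fun h'' => h (Subtype.ext h''.symm)) h'
    rw [i.2, j.2] at this
    exact lt_irrefl _ this

/-- For these inputs the coefficient counts the arrangements of `n` that dominate the sorted word `w
e` pointwise. Domination strictly increases the sum of the entries unless it is equality, so the
matrix is unitriangular for that weight. -/
theorem det_formCoeff_order (w : Sym (Fin m) k → Fin k → Fin m) (hmono : ∀ n, Monotone (w n))
    (hw : ∀ n, symOf (w n) = n) :
    (Matrix.of fun n e => formCoeff (fun j r : Fin m => if j ≤ r then 1 else 0) n (w e)).det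
      = 1 := by
  -- Since `w e` is sorted, the condition at time `τ` implies all the earlier ones.
  have hpp : ∀ e τ r, partialProd (fun j r : Fin m => if j ≤ r then 1 else 0) (w e) τ r =
      if w e τ ≤ r then 1 else 0 := by
    intro e τ r
    split_ifs with h
    · refine Finset.prod_eq_one fun s _ => ?_
      by_cases h1 : s ≤ τ
      · simp [h1, (hmono e h1).trans h]
      · simp [h1]
    · exact Finset.prod_eq_zero (Finset.mem_univ τ) (by simp [h])
  have hprod : ∀ e (ρ : Fin k → Fin m),
      ∏ τ, partialProd (fun j r : Fin m => if j ≤ r then 1 else 0) (w e) τ (ρ τ) =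
        if ∀ τ, w e τ ≤ ρ τ then 1 else 0 := by
    intro e ρ
    simp only [hpp]
    rw [Finset.prod_ite_zero]
    simp
  have hlt : ∀ (e : Sym (Fin m) k) (ρ : Fin k → Fin m), w e ≤ ρ → w e ≠ ρ →
      ∑ τ, (w e τ : ℕ) < ∑ τ, (ρ τ : ℕ) := by
    intro e ρ hle hne
    obtain ⟨τ, hτ⟩ := Function.ne_iff.1 hne
    exact Finset.sum_lt_sum (fun s _ => hle s) ⟨τ, Finset.mem_univ _, lt_of_le_of_ne (hle τ) (Fin.val_ne_of_ne hτ)⟩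
  have hsum : ∀ (n : Sym (Fin m) k) (ρ : Fin k → Fin m), symOf ρ = n →
      ∑ τ, (ρ τ : ℕ) = ∑ τ, (w n τ : ℕ) := by
    intro n ρ h
    have := prod_eq_of_symOf_eq (h.trans (hw n).symm) fun r => Multiplicative.ofAdd (r : ℕ)
    simpa [← ofAdd_sum] using this
  refine det_eq_one_of_weight _ (fun n => ∑ τ, (w n τ : ℕ)) (fun e => ?_) fun n e hne h => ?_
  · rw [Matrix.of_apply, formCoeff, Finset.sum_eq_single (w e)]
    · rw [hprod]; simp
    · intro ρ hρ hne
      rw [hprod, if_neg]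
      intro hle
      exact (hlt e ρ hle hne.symm).ne (hsum e ρ (Finset.mem_filter.1 hρ).2).symm
    · intro h; exact absurd (Finset.mem_filter.2 ⟨Finset.mem_univ (w e), hw e⟩) h
  · rw [Matrix.of_apply, formCoeff] at h
    obtain ⟨ρ, hρ, hρ0⟩ := Finset.exists_ne_zero_of_sum_ne_zero h
    have hρn := (Finset.mem_filter.1 hρ).2
    have hle : w e ≤ ρ := by
      by_contra hle
      exact hρ0 ((hprod e ρ).trans (if_neg hle))
    rw [← hsum n ρ hρn]
    refine hlt e ρ hle ?_
    rintro rfl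
    exact hne (hρn.symm.trans (hw e))

/-- The Gaussian kernel on a finite set of lattice points is nonsingular when it is narrow. -/
theorem det_pow_inner_ne_zero {ι : Type*} [Fintype ι] [DecidableEq ι] (n : ι → Fin m → ℕ)
    (hn : Function.Injective n) :
    (Matrix.of fun i j => (((Fintype.card ι : ℝ) + 1) ^ 2) ^ (∑ r, n i r * n j r)).det ≠ 0 := by
  set q : ℝ := (Fintype.card ι : ℝ) + 1 with hq
  have hq0 : 0 < q := by positivity
  have hq1 : 1 ≤ q := by rw [hq]; linarith [(Nat.cast_nonneg (Fintype.card ι) : (0 : ℝ) ≤ _)]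
  let D : ι → ι → ℕ := fun i j => ∑ r, ((n i r : ℤ) - n j r).natAbs ^ 2
  let K : Matrix ι ι ℝ := Matrix.of fun i j => q⁻¹ ^ D i j
  -- Polarization: up to diagonal factors the matrix is the kernel `K`, whose off-diagonal entries
  -- are at most `q⁻¹`. Since `q` exceeds the number of points, `K` is strictly diagonally dominant.
  have hD : ∀ i j, 2 * ∑ r, n i r * n j r + D i j = ∑ r, n i r ^ 2 + ∑ r, n j r ^ 2 := by
    intro i j
    simp only [D, Finset.mul_sum, ← Finset.sum_add_distrib]
    refine Finset.sum_congr rfl fun r _ => ?_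
    zify
    rw [sq_abs]
    ring
  have hfac : (Matrix.of fun i j => (q ^ 2) ^ (∑ r, n i r * n j r)) =
      diagonal (fun i => q ^ ∑ r, n i r ^ 2) * K * diagonal (fun i => q ^ ∑ r, n i r ^ 2) := by
    ext i j
    rw [mul_diagonal, diagonal_mul, Matrix.of_apply, show K i j = q⁻¹ ^ D i j from rfl, ← pow_mul,
      inv_pow, mul_right_comm, ← pow_add, ← hD, pow_add, mul_assoc, mul_inv_cancel₀ (by positivity), mul_one]
  have hK : K.det ≠ 0 := by
    refine det_ne_zero_of_sum_row_lt_diag fun i => ?_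
    have hii : K i i = 1 := by simp [K, D]
    rw [hii, norm_one]
    have hij : ∀ j ∈ Finset.univ.erase i, ‖K i j‖ ≤ q⁻¹ := by
      intro j hj
      have hne : D i j ≠ 0 := by
        intro h0
        apply Finset.ne_of_mem_erase hj
        apply hn
        ext r
        have := (Finset.sum_eq_zero_iff.1 h0) r (Finset.mem_univ r)
        have := pow_eq_zero_iff (two_ne_zero) |>.1 this
        omega
      rw [show K i j = q⁻¹ ^ D i j from rfl, Real.norm_of_nonneg (by positivity)]
      exact pow_le_of_le_one (by positivity) (inv_le_one_of_one_le₀ hq1) hne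
    calc ∑ j ∈ Finset.univ.erase i, ‖K i j‖ ≤ (Finset.univ.erase i).card • q⁻¹ :=
          Finset.sum_le_card_nsmul _ _ _ hij
      _ ≤ (Fintype.card ι : ℝ) * q⁻¹ := by
          rw [nsmul_eq_mul]
          gcongr
          exact Finset.card_le_univ _
      _ < 1 := by
          rw [← div_eq_mul_inv, div_lt_one hq0]
          linarith
  rw [hfac, det_mul, det_mul, det_diagonal]
  have : ∏ i, q ^ ∑ r, n i r ^ 2 ≠ 0 := Finset.prod_ne_zero_iff.2 fun i _ => by positivity
  exact mul_ne_zero (mul_ne_zero this hK) this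

/-- When letter `j` multiplies channel `j` by `z` and fixes the others, a monomial takes the value
`z` to the inner product of two multiplicity vectors, and a multiset is determined by its
multiplicities. -/
theorem exists_det_monomial_ne_zero (w : Sym (Fin m) k → Fin k → Fin m)
    (hw : ∀ n, symOf (w n) = n) :
    ∃ v : Fin m → Fin m → ℝ,
      (Matrix.of fun d n => ∏ τ, ∏ s, v (w d s) (w n τ)).det ≠ 0 := by
  let cnt : Sym (Fin m) k → Fin m → ℕ := fun d r => ∑ s, if w d s = r then 1 else 0
  have hcnt : ∀ d r, cnt d r = d.1.count r := by
    intro d r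
    conv_rhs => rw [← hw d]
    simp only [cnt, symOf, Multiset.count_map]
    rw [Finset.sum_boole]
    simp [Finset.card_def, eq_comm]
  have hinj : Function.Injective cnt := by
    intro d d' h
    refine Subtype.ext (Multiset.ext.2 fun r => ?_)
    rw [← hcnt, ← hcnt, h]
  refine ⟨fun j r => if j = r then ((Fintype.card (Sym (Fin m) k) : ℝ) + 1) ^ 2 else 1, ?_⟩
  convert det_pow_inner_ne_zero cnt hinj using 3
  ext d n
  set z : ℝ := ((Fintype.card (Sym (Fin m) k) : ℝ) + 1) ^ 2
  have : ∀ j r : Fin m, (if j = r then z else 1) = z ^ (if j = r then 1 else 0) := by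
    intro j r; split_ifs <;> simp
  simp only [this, Finset.prod_pow_eq_pow_sum]
  congr 1
  simp only [show ∀ r, cnt n r = ∑ τ : Fin k, if w n τ = r then 1 else 0 from fun r => rfl,
    Finset.mul_sum]
  conv_rhs => rw [Finset.sum_comm]
  refine Finset.sum_congr rfl fun τ _ => ?_
  simp [cnt]

theorem analyticAt_partialProd {t : ℕ} (d : Fin t → Fin m) (τ : Fin t) (r : Fin m)
    (v₀ : Fin m → Fin m → ℝ) : AnalyticAt ℝ (fun v => partialProd v d τ r) v₀ := by
  refine Finset.analyticAt_fun_prod _ fun s _ => ?_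
  split_ifs
  · exact analyticAt_entry _ _ v₀
  · exact analyticAt_const

theorem exists_det_two_layers_ne_zero (m k : ℕ) :
    ∃ (w : Sym (Fin m) k → Fin k → Fin m) (v : Fin m → Fin m → ℝ),
      (Matrix.of fun d e => (∏ τ, ∑ r, partialProd v (w d) τ r) *
        ∏ τ, ∑ r, (∏ s, v (w d s) r) * partialProd v (w e) τ r).det ≠ 0 := by
  choose w hmono hw using exists_monotone_symOf_eq (m := m) (k := k)
  obtain ⟨_, _⟩ := isAddHaarMeasure_volume_pi_pi m m
  obtain ⟨v₁, hv₁⟩ := exists_det_monomial_ne_zero w hw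
  have h1 := ae_ne_zero_of_analyticAt (volume : Measure (Fin m → Fin m → ℝ))
    (fun v₀ => analyticAt_det (A := fun v : Fin m → Fin m → ℝ =>
      Matrix.of fun d n => ∏ τ, ∏ s, v (w d s) (w n τ)) fun d n => by
        simp only [Matrix.of_apply]
        exact Finset.analyticAt_fun_prod _ fun τ _ => Finset.analyticAt_fun_prod _ fun s _ =>
          analyticAt_entry _ _ v₀) hv₁
  have h2 := ae_ne_zero_of_analyticAt (volume : Measure (Fin m → Fin m → ℝ))
    (fun v₀ => analyticAt_det (A := fun v : Fin m → Fin m → ℝ =>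
      Matrix.of fun n e => formCoeff v n (w e)) fun n e =>
        Finset.analyticAt_fun_sum _ fun ρ _ => Finset.analyticAt_fun_prod _ fun τ _ =>
          analyticAt_partialProd _ _ _ v₀)
    ((det_formCoeff_order w hmono hw).trans_ne one_ne_zero)
  have h3 : ∀ d, ∀ᵐ v : Fin m → Fin m → ℝ, ∏ τ, ∑ r, partialProd v (w d) τ r ≠ 0 := by
    intro d
    refine ae_ne_zero_of_analyticAt volume (fun v₀ =>
      Finset.analyticAt_fun_prod _ fun τ _ => Finset.analyticAt_fun_sum _ fun r _ =>
        analyticAt_partialProd _ _ _ v₀) (p := fun _ _ => 1) ?_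
    refine Finset.prod_ne_zero_iff.2 fun τ _ => ?_
    -- With all inputs equal to `1` each sum is `m`; the existence of a time `τ` forces `m` to be
    -- positive, and for `k = 0` the product is empty.
    have : m ≠ 0 := (Fin.pos (w d τ)).ne'
    simpa [partialProd] using this
  obtain ⟨v, ⟨hv1, hv2⟩, hv3⟩ := ((h1.and h2).and (ae_all_iff.2 h3)).exists
  refine ⟨w, v, ?_⟩
  have : (Matrix.of fun d e => (∏ τ, ∑ r, partialProd v (w d) τ r) *
        ∏ τ, ∑ r, (∏ s, v (w d s) r) * partialProd v (w e) τ r) =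
      diagonal (fun d => ∏ τ, ∑ r, partialProd v (w d) τ r) *
        ((Matrix.of fun d n => ∏ τ, ∏ s, v (w d s) (w n τ)) *
          Matrix.of fun n e => formCoeff v n (w e)) := by
    ext d e
    rw [diagonal_mul, Matrix.mul_apply, Matrix.of_apply,
      prod_sum_eq_sum_formCoeff v _ (w e) w hw]
    rfl
  rw [this, det_mul, det_mul, det_diagonal]
  exact mul_ne_zero (Finset.prod_ne_zero_iff.2 fun d _ => hv3 d) (mul_ne_zero hv1 hv2)

theorem ae_le_sepRankIn_two_layers (hR : 0 < R) (k : ℕ) {f : Fin M → X → ℝ}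
    (hf : LinearIndependent ℝ f) (c : Fin C) :
    ∀ᵐ θ : Params 1 R M C, ∀ P : ((Fin k → X) → ℝ) → Prop,
      (Nat.multichoose (min M R) k : ℕ∞) ≤ sepRankIn P (score f θ c) := by
  obtain ⟨x, hx⟩ := exists_points_det_ne_zero hf
  have hmM : min M R ≤ M := min_le_left _ _
  have hmR : min M R ≤ R := min_le_right _ _
  set m := min M R
  obtain ⟨w, v, hdet⟩ := exists_det_two_layers_ne_zero m k
  obtain ⟨U, hU⟩ := exists_inputWeights (R := R) hx fun j r =>
    if h : (j : ℕ) < m ∧ (r : ℕ) < m then v ⟨j, h.1⟩ ⟨r, h.2⟩ else 0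
  have hU' : ∀ j r, (U *ᵥ fun d => f d (x (Fin.castLE hmM j))) (Fin.castLE hmR r) = v j r := by
    intro j r
    rw [hU]
    simp
  let p : Fin m → X := fun j => x (Fin.castLE hmM j)
  have key := ae_card_le_sepRankIn f c (fun (d : Sym (Fin m) k) s => p (w d s))
    (fun e s => p (w e s)) (summingParams C m U)
  rw [Sym.card_sym_eq_multichoose, Fintype.card_fin] at key
  refine key ?_
  have : (Matrix.of fun d e : Sym (Fin m) k => score f (summingParams C m U) c
      (Fin.append (fun s => p (w d s)) fun s => p (w e s))) =
      (R : ℝ) • Matrix.of fun d e => (∏ τ, ∑ r, partialProd v (w d) τ r) *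
        ∏ τ, ∑ r, (∏ s, v (w d s) r) * partialProd v (w e) τ r := by
    ext d e
    exact score_summingParams_append f hmR U p v hU' c (w d) (w e)
  rw [this, det_smul]
  exact mul_ne_zero (pow_ne_zero _ (Nat.cast_ne_zero.2 hR.ne')) hdet

end TwoLayers

end RAC

theorem theorem1 {X : Type*} [MeasurableSpace X] (μ : MeasureTheory.Measure X)
    [MeasureTheory.SigmaFinite μ] (R M C k : ℕ) (hR : 0 < R)
    (f : Fin M → X → ℝ) (hind : LinearIndependent ℝ f)
    (hf : ∀ d, MeasureTheory.MemLp (f d) 2 μ) :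
    -- depth `L = 1`, with `T = k + k` time-steps
    (∀ᵐ θ : RAC.Params 0 R M C, ∀ c : Fin C,
      RAC.sepRank (k := k) (RAC.score f θ c) = (min R (M ^ k) : ℕ) ∧
      RAC.sepRankL2 μ (k := k) (RAC.score f θ c) = (min R (M ^ k) : ℕ)) ∧
    -- depth `L = 2`, with `T = k + k` time-steps
    (∀ᵐ θ : RAC.Params 1 R M C, ∀ c : Fin C,
      (Nat.multichoose (min M R) k : ℕ∞) ≤ RAC.sepRank (k := k) (RAC.score f θ c) ∧
      (Nat.multichoose (min M R) k : ℕ∞) ≤ RAC.sepRankL2 μ (k := k) (RAC.score f θ c)) := by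
  constructor
  · filter_upwards [ae_all_iff.2 fun c : Fin C => RAC.ae_le_sepRankIn_single (R := R) k hind c]
      with θ hθ c
    have hle := RAC.sepRankL2_le μ f hf θ c k
    -- A square-integrable decomposition is in particular a decomposition, so one upper bound serves
    -- both ranks.
    refine ⟨le_antisymm (le_trans ?_ hle) (hθ c _), le_antisymm hle (hθ c _)⟩
    refine sInf_le_sInf ?_
    rintro _ ⟨N, rfl, gs, ge, -, -, hy⟩
    exact ⟨N, rfl, gs, ge, fun _ => trivial, fun _ => trivial, hy⟩
  · filter_upwards [ae_all_iff.2 fun c : Fin C => RAC.ae_le_sepRankIn_two_layers hR k hind c]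
      with θ hθ c
    exact ⟨hθ c _, hθ c _⟩
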